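/- A matching of length $n\ge 0$ is a partition of $\{1,\dots,2n\}$ into $n$ blocks of size two, called arcs and written $[a,b]$ with $a<b$; $a$ is the opener and $b$ the closer. It is a Stoimenow matching if it has no two arcs $[i,\ell],[i+1,k]$ with $k<\ell$ and no two arcs $[k,j+1],[\ell,j]$ with $k<\ell$. Let $\mathcal M_n(P_2)$ be the set of Stoimenow matchings of length $n$ that avoid the pattern $P_2=\{[1,3],[2,5],[4,7],[6,8]\}$, i.e. that do not contain four arcs $[a_i,b_i]$ ($1\le i\le 4$) with $a_1<a_2<b_1<a_3<b_2<a_4<b_3<b_4$. For a Stoimenow matching $M$ let $\Omega(M)$ be the poset whose elements are the arcs of $M$, with $[a,b]<[a',b']$ if and only if $b<a'$; it is $(\mathbf{2+2})$-free. For a finite $(\mathbf{2+2})$-free poset $P$, the strict down-sets $D(x)=\{y : y<x\}$ form a chain $\emptyset=D_0\subsetneq D_1\subsetneq\dots\subsetneq D_t$, and $x$ is said to be at level $i$ if $D(x)=D_i$. Define a sequence $\mathcal O(P)$ of length $|P|$ recursively (the bijection of Bousquet-Mélou, Claesson, Dukes and Kitaev). For the empty poset it is the empty sequence. Otherwise let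 $i$ be the smallest level that contains a maximal element of $P$, and let $P'$ be obtained from $P$ as follows. If level $i$ has at least two elements, or if $i=t$, remove a maximal element at level $i$. If level $i$ has exactly one element and $i<t$, delete all relations $x<y$ with $x\in D_{i+1}\setminus D_i$ and then remove the element at level $i$. Then $P'$ is $(\mathbf{2+2})$-free and does not depend, up to isomorphism, on the choice made, and $\mathcal O(P)$ is $\mathcal O(P')$ followed by the entry $i$. Put $\Psi=\mathcal O\circ\Omega$. An ascent sequence of length $n$ is a sequence $(\alpha_1,\dots,\alpha_n)$ of nonnegative integers with $\alpha_1=0$ (if $n\ge1$) and $\alpha_i\le 1+\mathrm{asc}(\alpha_1,\dots,\alpha_{i-1})$ for $2\le i\le n$, where $\mathrm{asc}$ counts the indices $j$ with $\alpha_j<\alpha_{j+1}$. Let $\mathcal A_n(101)$ be the set of ascent sequences of length $n$ that avoid the pattern $101$, i.e. for which there are no $i<j<k$ with $\alpha_i=\alpha_k>\alpha_j$. **Theorem.** For every $n\ge 0$, the map $\Psi$ restricted to $\mathcal M_n(P_2)$ is a bijection from $\mathcal M_n(P_2)$ onto $\mathcal A_n(101)$. -/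

import Mathlib

/-! ### Matchings -/

/-- A matching on `2n` points (the points `1, …, 2n` are represented by `Fin (2 * n)`), i.e. a
partition of the points into blocks of size two, given by the map that sends each point to the
other point of its block. -/
@[ext]
structure ArcMatching (n : ℕ) where
  partner : Fin (2 * n) → Fin (2 * n)
  partner_partner : ∀ x, partner (partner x) = x
  partner_ne : ∀ x, partner x ≠ x

namespace ArcMatching

variable {n : ℕ}

/-- `[a, b]` is an arc of `M`, with opener `a` and closer `b`. -/
def IsArc (M : ArcMatching n) (a b : Fin (2 * n)) : Prop :=
  a < b ∧ M.partner a = b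

/-- No Type I arcs (an arc nested in another one, with adjacent openers) and no Type II arcs
(an arc nested in another one, with adjacent closers). -/
def IsStoimenow (M : ArcMatching n) : Prop :=
  (∀ a b c d, M.IsArc a b → M.IsArc c d → ¬ ((c : ℕ) = (a : ℕ) + 1 ∧ d < b)) ∧
  (∀ a b c d, M.IsArc a b → M.IsArc c d → ¬ (a < c ∧ (b : ℕ) = (d : ℕ) + 1))

/-- `M` contains the pattern `P₂ = {[1,3], [2,5], [4,7], [6,8]}`. -/
def ContainsP2 (M : ArcMatching n) : Prop :=
  ∃ a₁ b₁ a₂ b₂ a₃ b₃ a₄ b₄, M.IsArc a₁ b₁ ∧ M.IsArc a₂ b₂ ∧ M.IsArc a₃ b₃ ∧ M.IsArc a₄ b₄ ∧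
    a₁ < a₂ ∧ a₂ < b₁ ∧ b₁ < a₃ ∧ a₃ < b₂ ∧ b₂ < a₄ ∧ a₄ < b₃ ∧ b₃ < b₄

end ArcMatching

/-- The set `M_n(P₂)` of Stoimenow matchings with `n` arcs that avoid `P₂`. -/
def stoimenowAvoidingP2 (n : ℕ) : Set (ArcMatching n) :=
  {M | M.IsStoimenow ∧ ¬ M.ContainsP2}

/-! ### Finite posets -/

/-- A finite poset whose elements are labelled by elements of `ι`; `rel` is the graph of its
strict order. -/
@[ext]
structure FinPoset (ι : Type*) where
  carrier : Finset ι
  rel : Finset (ι × ι)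
  mem_of_rel : ∀ x y, (x, y) ∈ rel → x ∈ carrier ∧ y ∈ carrier
  irrefl : ∀ x, (x, x) ∉ rel
  trans : ∀ x y z, (x, y) ∈ rel → (y, z) ∈ rel → (x, z) ∈ rel

namespace FinPoset

variable {ι : Type*} [LinearOrder ι]

/-- The strict down-set `D(x)`. -/
def down (P : FinPoset ι) (x : ι) : Finset ι :=
  P.carrier.filter fun y => (y, x) ∈ P.rel

/-- The collection of strict down-sets of the elements of `P`.
If `P` is `(2+2)`-free, it is a chain `∅ = D₀ ⊂ D₁ ⊂ ⋯ ⊂ D_t`. -/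
def downSets (P : FinPoset ι) : Finset (Finset ι) :=
  P.carrier.image P.down

/-- The level of `x`: the index `i` with `D(x) = D_i`, i.e. the number of
strict down-sets properly contained in `D(x)`. -/
def level (P : FinPoset ι) (x : ι) : ℕ :=
  (P.downSets.filter fun D => D ⊂ P.down x).card

/-- The highest level `t` of a nonempty poset. -/
def topLevel (P : FinPoset ι) : ℕ :=
  P.downSets.card - 1

/-- The set of elements at level `i`. -/
def atLevel (P : FinPoset ι) (i : ℕ) : Finset ι :=
  P.carrier.filter fun x => P.level x = i

/-- The set of maximal elements. -/
def maximals (P : FinPoset ι) : Finset ι :=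
  P.carrier.filter fun x => ∀ y ∈ P.carrier, (x, y) ∉ P.rel

/-- The minimum level of a maximal element (`0` for the empty poset). -/
def minMaxLevel (P : FinPoset ι) : ℕ :=
  if h : P.maximals.Nonempty then P.maximals.inf' h P.level else 0

/-- The maximal elements that lie at the minimum level of a maximal element. They all have the
same strict down-set and nothing above them, so automorphisms of `P` permute them transitively
(when `P` is `(2+2)`-free). -/
def lowMaximals (P : FinPoset ι) : Finset ι :=
  P.maximals.filter fun x => P.level x = P.minMaxLevel

/-- The difference `D_{i+1} \ D_i` of consecutive strict down-sets. -/
def downDiff (P : FinPoset ι) (i : ℕ) : Finset ι :=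
  (P.atLevel (i + 1)).biUnion P.down \ (P.atLevel i).biUnion P.down

/-- Delete all relations `x < y` with `x ∈ N`. -/
def deleteRel (P : FinPoset ι) (N : Finset ι) : FinPoset ι where
  carrier := P.carrier
  rel := P.rel.filter fun p => p.1 ∉ N
  mem_of_rel x y h := P.mem_of_rel x y (Finset.mem_filter.1 h).1
  irrefl x h := P.irrefl x (Finset.mem_filter.1 h).1
  trans x y z h h' := Finset.mem_filter.2
    ⟨P.trans x y z (Finset.mem_filter.1 h).1 (Finset.mem_filter.1 h').1,
      (Finset.mem_filter.1 h).2⟩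

/-- Remove the element `m`. -/
def erase (P : FinPoset ι) (m : ι) : FinPoset ι where
  carrier := P.carrier.erase m
  rel := P.rel.filter fun p => p.1 ≠ m ∧ p.2 ≠ m
  mem_of_rel x y h :=
    ⟨Finset.mem_erase.2 ⟨(Finset.mem_filter.1 h).2.1,
        (P.mem_of_rel x y (Finset.mem_filter.1 h).1).1⟩,
      Finset.mem_erase.2 ⟨(Finset.mem_filter.1 h).2.2,
        (P.mem_of_rel x y (Finset.mem_filter.1 h).1).2⟩⟩
  irrefl x h := P.irrefl x (Finset.mem_filter.1 h).1
  trans x y z h h' := Finset.mem_filter.2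
    ⟨P.trans x y z (Finset.mem_filter.1 h).1 (Finset.mem_filter.1 h').1,
      (Finset.mem_filter.1 h).2.1, (Finset.mem_filter.1 h').2.2⟩

/-- One removal step of Bousquet-Mélou, Claesson, Dukes and Kitaev. Let `i` be the minimum level
of a maximal element.
* If there are at least two elements at level `i`, or if `i` is the highest level, remove a maximal
  element at level `i` (any choice gives the same poset up to isomorphism; the one with the
  smallest label is taken).
* If there is just one element at level `i` and `i` is not the highest level, first make every
  element of `D_{i+1} \ D_i` maximal by deleting all relations `x < y` with `x` in that set, then
  remove the element at level `i`. -/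
def removeStep (P : FinPoset ι) : FinPoset ι :=
  if h : P.lowMaximals.Nonempty then
    if (P.atLevel P.minMaxLevel).card = 1 ∧ P.minMaxLevel < P.topLevel then
      (P.deleteRel (P.downDiff P.minMaxLevel)).erase (P.lowMaximals.min' h)
    else
      P.erase (P.lowMaximals.min' h)
  else P

/-- Record the minimum level of a maximal element before each of `k` successive removal steps;
the last recorded value is the first entry of the sequence. -/
def removalLevels : ℕ → FinPoset ι → List ℕ
  | 0, _ => []
  | k + 1, P => removalLevels k P.removeStep ++ [P.minMaxLevel]

/-- The map `O` from `(2+2)`-free posets to ascent sequences: the last entry of `O(P)` is the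
minimum level of a maximal element of `P`, the preceding entries are `O(P')`, where `P'` arises
from `P` by a removal step. -/
def toAscentSeq (P : FinPoset ι) : List ℕ :=
  removalLevels P.carrier.card P

end FinPoset

/-! ### The maps `Ω` and `Ψ` -/

namespace ArcMatching

variable {n : ℕ}

/-- The map `Ω`: the poset on the arcs of `M` (each labelled by its opener) in which
`[a, b] < [a', b']` if and only if `b < a'`. -/
def toPoset (M : ArcMatching n) : FinPoset (Fin (2 * n)) where
  carrier := Finset.univ.filter fun a => a < M.partner a
  rel := Finset.univ.filter fun p =>
    p.1 < M.partner p.1 ∧ p.2 < M.partner p.2 ∧ M.partner p.1 < p.2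
  mem_of_rel x y h := by
    simp only [Finset.mem_filter, Finset.mem_univ, true_and] at h ⊢
    exact ⟨h.1, h.2.1⟩
  irrefl x h := by
    simp only [Finset.mem_filter, Finset.mem_univ, true_and] at h
    exact absurd (h.1.trans h.2.2) (lt_irrefl x)
  trans x y z h h' := by
    simp only [Finset.mem_filter, Finset.mem_univ, true_and] at h h' ⊢
    exact ⟨h.1, h'.2.1, h.2.2.trans (h.2.1.trans h'.2.2)⟩

/-- The composite `Ψ = O ∘ Ω`. -/
def toAscentSeq (M : ArcMatching n) : List ℕ :=
  M.toPoset.toAscentSeq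

end ArcMatching

/-! ### Ascent sequences -/

/-- The number of ascents of a sequence, i.e. of indices `i` with `α_i < α_{i+1}`. -/
def ascents (l : List ℕ) : ℕ :=
  (l.zip l.tail).countP fun p => p.1 < p.2

/-- `l` is an ascent sequence of length `n`. -/
def IsAscentSeq (n : ℕ) (l : List ℕ) : Prop :=
  l.length = n ∧ (∀ h : 0 < l.length, l[0] = 0) ∧
    ∀ i (h : i < l.length), 1 ≤ i → l[i] ≤ 1 + ascents (l.take i)

/-- `l` contains the pattern `101`: it has a subsequence `a, b, a` with `b < a`. -/
def Contains101 (l : List ℕ) : Prop :=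
  ∃ a b, b < a ∧ [a, b, a].Sublist l

/-- The set `A_n(101)` of ascent sequences of length `n` that avoid `101`. -/
def ascentSeqAvoiding101 (n : ℕ) : Set (List ℕ) :=
  {l | IsAscentSeq n l ∧ ¬ Contains101 l}


/-! Read from left to right, a matching alternates between runs of openers and runs of closers; give
the `v`-th run of openers and the run of closers after it the number `v`, starting from `0`. The
arcs then become intervals `[u, v]` of run numbers, which represent the poset `Ω(M)` as an interval
order. A Stoimenow matching is determined by the multiset of these intervals, because within a run
its points are sorted by their partners. It avoids `P₂` if and only if the intervals are laminar:
any two that meet are nested. In that case every singleton `[v, v]` occurs.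

Sort the intervals by increasing right end, then by decreasing left end. The singletons make the
left end of an interval the level of its element, and ensure that every removal step just removes
the last interval; so `Ψ(M)` is the list of left ends. For a laminar list the right ends are the
running maxima of the left ends, and the lists of left ends that arise are the restricted growth
functions that avoid `101`, which are the ascent sequences that avoid `101`. -/

section RestrictedGrowth

/-- A restricted growth function: every value below an entry occurs earlier. For sequences avoiding
`101` this is the same as being an ascent sequence, see `isAscentSeq_ofFn_iff`. -/
def IsRestrictedGrowth {ι : Type*} [LT ι] (α : ι → ℕ) : Prop :=
  ∀ k, ∀ v < α k, ∃ j < k, α j = v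

/-- Avoidance of the pattern `101`, for sequences given as functions of an index. -/
def Avoids101 {ι : Type*} [LT ι] (α : ι → ℕ) : Prop :=
  ∀ ⦃i j k⦄, i < j → j < k → α i = α k → α k ≤ α j

variable {ι : Type*} [LinearOrder ι] [LocallyFiniteOrderBot ι] {α : ι → ℕ}

theorem exists_le_partialSups_eq (α : ι → ℕ) (k : ι) : ∃ j ≤ k, partialSups α k = α j := by
  simpa only [partialSups_apply, Finset.mem_Iic] using
    Finset.exists_mem_eq_sup' Finset.nonempty_Iic α

theorem IsRestrictedGrowth.exists_eq_and_partialSups_eq [WellFoundedLT ι]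
    (hα : IsRestrictedGrowth α) {k : ι} {v : ℕ} (hv : v ≤ partialSups α k) :
    ∃ j ≤ k, α j = v ∧ partialSups α j = v := by
  obtain ⟨j, hjk, hj⟩ := exists_minimal_le_of_wellFoundedLT (v ≤ partialSups α ·) k hv
  obtain ⟨i, hij, hi⟩ := exists_le_partialSups_eq α j
  have hiv : α i = v := by
    refine (hj.prop.trans_eq hi).antisymm' (not_lt.1 fun hlt => ?_)
    obtain ⟨i', hi', rfl⟩ := hα i v hlt
    exact hj.not_prop_of_lt (hi'.trans_le hij) (le_partialSups α i')
  obtain rfl : i = j := hij.antisymm (hj.le_of_le (hiv ▸ le_partialSups α i) hij)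
  exact ⟨i, hjk, hiv, hi.trans hiv⟩

theorem IsRestrictedGrowth.partialSups_lt [WellFoundedLT ι] (hα : IsRestrictedGrowth α)
    (h101 : Avoids101 α) {j k : ι} (hjk : j < k) (hlt : α j < α k) : partialSups α j < α k := by
  by_contra! hle
  obtain ⟨i, hij, hi, -⟩ := hα.exists_eq_and_partialSups_eq hle
  have hne : i ≠ j := by
    rintro rfl
    exact hlt.ne hi
  exact hlt.not_ge (h101 (hij.lt_of_ne hne) hjk hi)

end RestrictedGrowth

section AscentSequences

theorem ascents_append_pair (l : List ℕ) (b a : ℕ) :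
    ascents (l ++ [b, a]) = ascents (l ++ [b]) + if b < a then 1 else 0 := by
  induction l with
  | nil => simp [ascents, List.countP_cons]
  | cons c l ih =>
    cases l with
    | nil => simp [ascents, List.countP_cons, add_comm]
    | cons d l =>
      simp only [ascents, List.cons_append, List.tail_cons, List.zip_cons_cons,
        List.countP_cons] at ih ⊢
      omega

theorem isAscentSeq_concat_iff {n : ℕ} {l : List ℕ} {a : ℕ} :
    IsAscentSeq (n + 1) (l ++ [a]) ↔
      IsAscentSeq n l ∧ (n = 0 → a = 0) ∧ (n ≠ 0 → a ≤ 1 + ascents l) := by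
  simp only [IsAscentSeq, List.length_append, List.length_singleton, Nat.add_right_cancel_iff,
    and_assoc]
  refine and_congr_right fun hl => ⟨fun ⟨h0, h1⟩ => ⟨fun h => ?_, fun i hi hpos => ?_, ?_, ?_⟩,
    fun ⟨h0, h1, ha0, ha⟩ => ⟨fun _ => ?_, fun i hi hpos => ?_⟩⟩
  · simpa [List.getElem_append_left h] using h0 (by omega)
  · simpa [List.getElem_append_left hi, List.take_append_of_le_length hi.le] using
      h1 i (by omega) hpos
  · rintro rfl
    obtain rfl := List.length_eq_zero_iff.1 hl
    simpa using h0
  · intro hn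
    simpa using h1 l.length (by omega) (by omega)
  · rcases l.eq_nil_or_concat with rfl | ⟨l', b, rfl⟩
    · exact ha0 hl.symm
    · rw [List.getElem_append_left (by simp)]
      exact h0 (by simp)
  · rcases (Nat.lt_succ_iff.1 hi).lt_or_eq with hlt | rfl
    · rw [List.getElem_append_left hlt, List.take_append_of_le_length hlt.le]
      exact h1 i hlt hpos
    · simpa using ha (by omega)

variable {n : ℕ} {α : Fin n → ℕ}

theorem not_contains101_ofFn_iff : ¬ Contains101 (List.ofFn α) ↔ Avoids101 α := by
  constructor
  · intro h i j k hij hjk hik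
    by_contra! hlt
    refine h ⟨α k, α j, hlt, ?_⟩
    have hsub : [i, j, k].Sublist (List.finRange n) := by
      simpa using List.map_getElem_sublist (l := List.finRange n)
        (is := [i.cast (by simp), j.cast (by simp), k.cast (by simp)])
        (by simp [hij, hjk, hij.trans hjk])
    simpa [List.ofFn_eq_map, hik] using hsub.map α
  · rintro h ⟨a, b, hab, hsub⟩
    obtain ⟨f, hf⟩ := List.sublist_iff_exists_fin_orderEmbedding_get_eq.1 hsub
    have h0 := hf ⟨0, by simp⟩
    have h1 := hf ⟨1, by simp⟩
    have h2 := hf ⟨2, by simp⟩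
    have h01 : f ⟨0, by simp⟩ < f ⟨1, by simp⟩ := f.strictMono (by simp)
    have h12 : f ⟨1, by simp⟩ < f ⟨2, by simp⟩ := f.strictMono (by simp)
    simp only [List.get_ofFn] at h0 h1 h2
    exact hab.not_ge ((h2.trans_le (h h01 h12 (h0.symm.trans h2))).trans_eq h1.symm)

theorem partialSups_init {α : Fin (n + 1) → ℕ} (k : Fin n) :
    partialSups (Fin.init α) k = partialSups α k.castSucc := by
  refine eq_of_forall_ge_iff fun m => ?_
  simp [partialSups_le_iff, Fin.forall_fin_succ', Fin.init, (Fin.castSucc_lt_last k).not_ge]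

theorem partialSups_last (α : Fin (n + 2) → ℕ) : partialSups α (Fin.last (n + 1)) =
    max (partialSups (Fin.init α) (Fin.last n)) (α (Fin.last (n + 1))) := by
  refine eq_of_forall_ge_iff fun m => ?_
  simp [partialSups_le_iff, Fin.forall_fin_succ', Fin.init, Fin.le_last]

theorem Avoids101.init {α : Fin (n + 1) → ℕ} (h : Avoids101 α) : Avoids101 (Fin.init α) :=
  fun i j k hij hjk hik =>
    h (i := i.castSucc) (j := j.castSucc) (k := k.castSucc) hij hjk hik

theorem isRestrictedGrowth_succ_iff {α : Fin (n + 1) → ℕ} : IsRestrictedGrowth α ↔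
    IsRestrictedGrowth (Fin.init α) ∧ ∀ v < α (Fin.last n), ∃ j, Fin.init α j = v := by
  simp [IsRestrictedGrowth, Fin.forall_fin_succ', Fin.exists_fin_succ', Fin.init,
    (Fin.castSucc_lt_last _).not_gt]

theorem isRestrictedGrowth_succ_succ_iff {α : Fin (n + 2) → ℕ} : IsRestrictedGrowth α ↔
    IsRestrictedGrowth (Fin.init α) ∧
      α (Fin.last (n + 1)) ≤ partialSups (Fin.init α) (Fin.last n) + 1 := by
  rw [isRestrictedGrowth_succ_iff]
  refine and_congr_right fun hinit => ⟨fun h => ?_, fun hle v hv => ?_⟩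
  · by_contra! hlt
    obtain ⟨j, hj⟩ := h _ hlt
    have := le_partialSups_of_le (Fin.init α) (Fin.le_last j)
    omega
  · obtain ⟨j, -, hj, -⟩ := hinit.exists_eq_and_partialSups_eq (Nat.lt_succ_iff.1 (hv.trans_le hle))
    exact ⟨j, hj⟩

theorem IsRestrictedGrowth.apply_zero {α : Fin (n + 1) → ℕ} (hα : IsRestrictedGrowth α) :
    α 0 = 0 := by
  by_contra! hne
  obtain ⟨j, hj, -⟩ := hα 0 0 (Nat.pos_of_ne_zero hne)
  exact Fin.not_lt_zero j hj

theorem ofFn_eq_ofFn_init_append (α : Fin (n + 1) → ℕ) :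
    List.ofFn α = List.ofFn (Fin.init α) ++ [α (Fin.last n)] :=
  List.ofFn_succ_last

theorem ascents_ofFn_eq_partialSups {α : Fin (n + 1) → ℕ} (hα : IsRestrictedGrowth α)
    (h101 : Avoids101 α) : ascents (List.ofFn α) = partialSups α (Fin.last n) := by
  induction n with
  | zero =>
    change _ = partialSups α ⊥
    rw [partialSups_bot]
    exact hα.apply_zero.symm
  | succ n ih =>
    obtain ⟨hinit, hle⟩ := isRestrictedGrowth_succ_succ_iff.1 hα
    have hstep : ascents (List.ofFn α) = ascents (List.ofFn (Fin.init α)) +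
        if Fin.init α (Fin.last n) < α (Fin.last (n + 1)) then 1 else 0 := by
      rw [ofFn_eq_ofFn_init_append α, ofFn_eq_ofFn_init_append (Fin.init α), List.append_assoc]
      exact ascents_append_pair _ _ _
    rw [hstep, ih hinit h101.init, partialSups_last]
    split_ifs with hlt
    · have hnew := hα.partialSups_lt h101 (Fin.castSucc_lt_last _) hlt
      rw [← partialSups_init] at hnew
      omega
    · have hle : Fin.init α (Fin.last n) ≤ _ := le_partialSups (Fin.init α) (Fin.last n)
      omega

theorem isAscentSeq_ofFn_iff (h101 : Avoids101 α) :
    IsAscentSeq n (List.ofFn α) ↔ IsRestrictedGrowth α := by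
  induction n with
  | zero => simp [IsAscentSeq, IsRestrictedGrowth]
  | succ n ih =>
    rw [ofFn_eq_ofFn_init_append, isAscentSeq_concat_iff, ih h101.init]
    cases n with
    | zero =>
      rw [isRestrictedGrowth_succ_iff]
      refine and_congr_right fun hinit => ⟨fun h v hv => ?_, fun h => ⟨fun _ => ?_, by simp⟩⟩
      · exact absurd (hv.trans_eq (h.1 rfl)) (Nat.not_lt_zero v)
      · exact (isRestrictedGrowth_succ_iff.2 ⟨hinit, h⟩).apply_zero
    | succ n =>
      rw [isRestrictedGrowth_succ_succ_iff]
      refine and_congr_right fun hinit => ?_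
      rw [ascents_ofFn_eq_partialSups hinit h101.init, add_comm 1]
      simp

end AscentSequences

/-- A list of closed intervals `[(c k).1, (c k).2]`, sorted by increasing right end and then
decreasing left end, that is laminar (no two of its intervals cross or touch without one containing
the other) and contains the singleton of every number up to a right end. These are the codes of the
matchings in `stoimenowAvoidingP2`, see `image_ofCode_isLaminarCode`: the interval of an arc
records the runs of its opener and of its closer. -/
structure IsLaminarCode {n : ℕ} (c : Fin n → ℕ × ℕ) : Prop where
  fst_le_snd : ∀ k, (c k).1 ≤ (c k).2
  laminar : ∀ j k, (c j).1 < (c k).1 → (c k).1 ≤ (c j).2 → (c k).2 ≤ (c j).2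
  exists_diag : ∀ k, ∀ v ≤ (c k).2, ∃ j, c j = (v, v)
  sorted : ∀ j k, j < k → (c j).2 < (c k).2 ∨ (c j).2 = (c k).2 ∧ (c k).1 ≤ (c j).1

namespace IsLaminarCode

variable {n : ℕ} {c : Fin n → ℕ × ℕ}

theorem snd_le_snd (hc : IsLaminarCode c) {j k : Fin n} (hjk : j ≤ k) : (c j).2 ≤ (c k).2 := by
  rcases hjk.eq_or_lt with rfl | hlt
  · rfl
  · exact (hc.sorted j k hlt).elim le_of_lt fun h => h.1.le

theorem exists_diag_le (hc : IsLaminarCode c) {k : Fin n} {v : ℕ} (hv : v ≤ (c k).2) :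
    ∃ j ≤ k, c j = (v, v) := by
  obtain ⟨j, hj⟩ := hc.exists_diag k v hv
  rcases le_or_gt j k with hjk | hkj
  · exact ⟨j, hjk, hj⟩
  · have hsorted := hc.sorted k j hkj
    have hle := hc.fst_le_snd k
    simp only [hj] at hsorted
    exact ⟨k, le_rfl, Prod.ext (by dsimp only; omega) (by dsimp only; omega)⟩

theorem fst_le_snd_of_le (hc : IsLaminarCode c) {j k : Fin n} (hjk : j ≤ k) :
    (c j).1 ≤ (c k).2 :=
  (hc.fst_le_snd j).trans (hc.snd_le_snd hjk)

theorem init {c : Fin (n + 1) → ℕ × ℕ} (hc : IsLaminarCode c) : IsLaminarCode (Fin.init c) where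
  fst_le_snd k := hc.fst_le_snd k.castSucc
  laminar j k := hc.laminar j.castSucc k.castSucc
  exists_diag k v hv := by
    obtain ⟨j, hjk, hj⟩ := hc.exists_diag_le hv
    exact ⟨j.castLT ((Fin.le_def.1 hjk).trans_lt k.2), hj⟩
  sorted j k hjk := hc.sorted j.castSucc k.castSucc hjk

theorem partialSups_fst (hc : IsLaminarCode c) (k : Fin n) :
    partialSups (fun k => (c k).1) k = (c k).2 := by
  apply le_antisymm
  · exact partialSups_le _ _ _ fun j => hc.fst_le_snd_of_le
  · obtain ⟨j, hjk, hj⟩ := hc.exists_diag_le (le_refl (c k).2)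
    simpa [hj] using le_partialSups_of_le (fun k => (c k).1) hjk

theorem isRestrictedGrowth_fst (hc : IsLaminarCode c) :
    IsRestrictedGrowth fun k => (c k).1 := by
  intro k v hv
  obtain ⟨j, hjk, hj⟩ := hc.exists_diag_le (hv.le.trans (hc.fst_le_snd k))
  refine ⟨j, hjk.lt_of_ne ?_, by simp [hj]⟩
  rintro rfl
  simp [hj] at hv

theorem avoids101_fst (hc : IsLaminarCode c) : Avoids101 fun k => (c k).1 := by
  intro i j k hij hjk hik
  have hlam := hc.laminar j k
  have hle := hc.fst_le_snd_of_le hij.le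
  have hsorted := hc.sorted j k hjk
  dsimp only at hik ⊢
  omega

end IsLaminarCode

theorem isLaminarCode_partialSups {n : ℕ} {α : Fin n → ℕ} (hα : IsRestrictedGrowth α)
    (h101 : Avoids101 α) : IsLaminarCode fun k => (α k, partialSups α k) where
  fst_le_snd k := le_partialSups α k
  laminar j k hlt hle := by
    rcases lt_or_ge j k with hjk | hkj
    · exact absurd (hα.partialSups_lt h101 hjk hlt) hle.not_gt
    · exact (partialSups α).monotone hkj
  exists_diag k v hv := by
    obtain ⟨j, -, hj, hj'⟩ := hα.exists_eq_and_partialSups_eq hv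
    exact ⟨j, Prod.ext hj hj'⟩
  sorted j k hjk := by
    refine ((partialSups α).monotone hjk.le).lt_or_eq.imp_right fun heq => ⟨heq, ?_⟩
    by_contra! hlt
    exact (hα.partialSups_lt h101 hjk hlt).not_ge ((le_partialSups α k).trans_eq heq.symm)

theorem bijOn_ofFn_fst (n : ℕ) :
    Set.BijOn (fun c : Fin n → ℕ × ℕ => List.ofFn fun k => (c k).1) {c | IsLaminarCode c}
      (ascentSeqAvoiding101 n) := by
  refine ⟨fun c hc => ?_, fun c hc d hd h => ?_, fun l hl => ?_⟩
  · exact ⟨(isAscentSeq_ofFn_iff hc.avoids101_fst).2 hc.isRestrictedGrowth_fst,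
      not_contains101_ofFn_iff.2 hc.avoids101_fst⟩
  · have hfst : (fun k => (c k).1) = fun k => (d k).1 := List.ofFn_injective h
    funext k
    refine Prod.ext (congrFun hfst k) ?_
    rw [← hc.partialSups_fst, hfst, hd.partialSups_fst]
  · obtain ⟨α, rfl⟩ : ∃ α : Fin n → ℕ, List.ofFn α = l := by
      obtain rfl := hl.1.1
      exact ⟨l.get, List.ofFn_get l⟩
    have h101 := not_contains101_ofFn_iff.1 hl.2
    exact ⟨_, isLaminarCode_partialSups ((isAscentSeq_ofFn_iff h101).1 hl.1) h101, rfl⟩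

namespace FinPoset

variable {ι : Type*} {P : FinPoset ι} {f : ι → ℕ × ℕ}

/-- The intervals `f x`, for `x` in `P`, represent `P` as an interval order, and their left ends, as
well as their right ends, are exactly the numbers `0, …, t`. For such a representation the left end
of an interval is the level of the element that it represents. -/
structure IsCanonicalRep (P : FinPoset ι) (f : ι → ℕ × ℕ) (t : ℕ) : Prop where
  rel_iff : ∀ x ∈ P.carrier, ∀ y ∈ P.carrier, ((x, y) ∈ P.rel ↔ (f x).2 < (f y).1)
  fst_le : ∀ x ∈ P.carrier, (f x).1 ≤ t
  snd_le : ∀ x ∈ P.carrier, (f x).2 ≤ t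
  exists_fst_eq : ∀ v ≤ t, ∃ x ∈ P.carrier, (f x).1 = v
  exists_snd_eq : ∀ v ≤ t, ∃ x ∈ P.carrier, (f x).2 = v

namespace IsCanonicalRep

variable {t : ℕ}

theorem strictMonoOn_filter_snd_lt (h : P.IsCanonicalRep f t) :
    StrictMonoOn (fun v => P.carrier.filter fun y => (f y).2 < v) (Set.Iic t) := by
  intro u hu v _ huv
  obtain ⟨x, hx, rfl⟩ := h.exists_snd_eq u hu
  refine Finset.ssubset_iff_of_subset (Finset.monotone_filter_right _ fun y _ hy => hy.trans huv)
    |>.2 ⟨x, ?_, ?_⟩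
  · exact Finset.mem_filter.2 ⟨hx, huv⟩
  · simp

variable [LinearOrder ι]

theorem down_eq (h : P.IsCanonicalRep f t) {x : ι} (hx : x ∈ P.carrier) :
    P.down x = P.carrier.filter fun y => (f y).2 < (f x).1 :=
  Finset.filter_congr fun y hy => h.rel_iff y hy x hx

theorem downSets_eq (h : P.IsCanonicalRep f t) : P.downSets =
    (Finset.Iic t).image fun v => P.carrier.filter fun y => (f y).2 < v := by
  ext D
  simp only [downSets, Finset.mem_image, Finset.mem_Iic]
  constructor
  · rintro ⟨x, hx, rfl⟩
    exact ⟨(f x).1, h.fst_le x hx, (h.down_eq hx).symm⟩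
  · rintro ⟨v, hv, rfl⟩
    obtain ⟨x, hx, rfl⟩ := h.exists_fst_eq v hv
    exact ⟨x, hx, h.down_eq hx⟩

theorem topLevel_eq (h : P.IsCanonicalRep f t) : P.topLevel = t := by
  rw [topLevel, h.downSets_eq, Finset.card_image_of_injOn, Nat.card_Iic, Nat.add_sub_cancel]
  simpa using h.strictMonoOn_filter_snd_lt.injOn

theorem level_eq (h : P.IsCanonicalRep f t) {x : ι} (hx : x ∈ P.carrier) :
    P.level x = (f x).1 := by
  have hlt : (Finset.Iic t).filter (fun v => (P.carrier.filter fun y => (f y).2 < v) ⊂ P.down x) =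
      Finset.Iio (f x).1 := by
    ext v
    simp only [Finset.mem_filter, Finset.mem_Iic, Finset.mem_Iio, h.down_eq hx]
    have hle := h.fst_le x hx
    refine ⟨fun hv => (h.strictMonoOn_filter_snd_lt.lt_iff_lt hv.1 hle).1 hv.2, fun hv => ?_⟩
    have hvt := hv.le.trans hle
    exact ⟨hvt, h.strictMonoOn_filter_snd_lt hvt hle hv⟩
  rw [level, h.downSets_eq, Finset.filter_image, Finset.card_image_of_injOn, hlt, Nat.card_Iio]
  exact h.strictMonoOn_filter_snd_lt.injOn.mono fun v hv =>
    Finset.mem_Iic.1 (Finset.mem_filter.1 hv).1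

theorem mem_maximals_iff (h : P.IsCanonicalRep f t) {x : ι} :
    x ∈ P.maximals ↔ x ∈ P.carrier ∧ (f x).2 = t := by
  simp only [maximals, Finset.mem_filter]
  refine and_congr_right fun hx => ⟨fun hmax => ?_, fun heq y hy => ?_⟩
  · obtain ⟨y, hy, hyt⟩ := h.exists_fst_eq t le_rfl
    have := hmax y hy
    rw [h.rel_iff x hx y hy, hyt, not_lt] at this
    exact (h.snd_le x hx).antisymm this
  · rw [h.rel_iff x hx y hy, heq]
    exact (h.fst_le y hy).not_gt

end IsCanonicalRep

/-- The intervals `f x`, for `x` in `P`, represent `P` as an interval order and form the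
multiset of intervals listed by `c`. -/
structure IsRepresentedBy (P : FinPoset ι) (f : ι → ℕ × ℕ) {n : ℕ} (c : Fin n → ℕ × ℕ) : Prop where
  rel_iff : ∀ x ∈ P.carrier, ∀ y ∈ P.carrier, ((x, y) ∈ P.rel ↔ (f x).2 < (f y).1)
  map_eq : P.carrier.val.map f = Finset.univ.val.map c

namespace IsRepresentedBy

variable {n : ℕ}

theorem exists_eq_iff {c : Fin n → ℕ × ℕ} (h : P.IsRepresentedBy f c) (p : ℕ × ℕ) :
    (∃ x ∈ P.carrier, f x = p) ↔ ∃ k, c k = p := by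
  have hmem : p ∈ P.carrier.val.map f ↔ p ∈ Finset.univ.val.map c := by rw [h.map_eq]
  simpa using hmem

section LaminarCode

variable {c : Fin (n + 1) → ℕ × ℕ}

theorem isCanonicalRep (h : P.IsRepresentedBy f c) (hc : IsLaminarCode c) :
    P.IsCanonicalRep f (c (Fin.last n)).2 where
  rel_iff := h.rel_iff
  fst_le x hx := by
    obtain ⟨k, hk⟩ := (h.exists_eq_iff _).1 ⟨x, hx, rfl⟩
    exact hk ▸ hc.fst_le_snd_of_le k.le_last
  snd_le x hx := by
    obtain ⟨k, hk⟩ := (h.exists_eq_iff _).1 ⟨x, hx, rfl⟩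
    exact hk ▸ hc.snd_le_snd k.le_last
  exists_fst_eq v hv := by
    obtain ⟨x, hx, hxv⟩ := (h.exists_eq_iff _).2 (hc.exists_diag _ v hv)
    exact ⟨x, hx, congrArg Prod.fst hxv⟩
  exists_snd_eq v hv := by
    obtain ⟨x, hx, hxv⟩ := (h.exists_eq_iff _).2 (hc.exists_diag _ v hv)
    exact ⟨x, hx, congrArg Prod.snd hxv⟩

variable [LinearOrder ι]

theorem minMaxLevel_eq (h : P.IsRepresentedBy f c) (hc : IsLaminarCode c) :
    P.minMaxLevel = (c (Fin.last n)).1 := by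
  have hcan := h.isCanonicalRep hc
  obtain ⟨x, hx, hxc⟩ := (h.exists_eq_iff (c (Fin.last n))).2 ⟨_, rfl⟩
  have hxm : x ∈ P.maximals := hcan.mem_maximals_iff.2 ⟨hx, by rw [hxc]⟩
  rw [minMaxLevel, dif_pos ⟨x, hxm⟩, ← hxc, ← hcan.level_eq hx]
  refine (Finset.inf'_le _ hxm).antisymm (Finset.le_inf' _ _ fun y hym => ?_)
  obtain ⟨hy, hyt⟩ := hcan.mem_maximals_iff.1 hym
  obtain ⟨k, hk⟩ := (h.exists_eq_iff _).1 ⟨y, hy, rfl⟩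
  rw [hcan.level_eq hx, hcan.level_eq hy, hxc, ← hk]
  rcases k.le_last.eq_or_lt with rfl | hlt
  · rfl
  · exact (hc.sorted k _ hlt).elim (fun h' => absurd (hk ▸ hyt) h'.ne) And.right

theorem mem_lowMaximals_iff (h : P.IsRepresentedBy f c) (hc : IsLaminarCode c) {x : ι} :
    x ∈ P.lowMaximals ↔ x ∈ P.carrier ∧ f x = c (Fin.last n) := by
  have hcan := h.isCanonicalRep hc
  simp only [lowMaximals, Finset.mem_filter, hcan.mem_maximals_iff, h.minMaxLevel_eq hc, and_assoc]
  refine and_congr_right fun hx => ?_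
  rw [hcan.level_eq hx, Prod.ext_iff, and_comm]

/-- If the lowest level `i` of a maximal element is not the top level, then it contains, besides
that element, one that is represented by `(i, i)`. So no relations get deleted. -/
theorem exists_removeStep_eq_erase (h : P.IsRepresentedBy f c) (hc : IsLaminarCode c) :
    ∃ m ∈ P.carrier, f m = c (Fin.last n) ∧ P.removeStep = P.erase m := by
  have hcan := h.isCanonicalRep hc
  have hne : P.lowMaximals.Nonempty := by
    obtain ⟨x, hx⟩ := (h.exists_eq_iff (c (Fin.last n))).2 ⟨_, rfl⟩
    exact ⟨x, (h.mem_lowMaximals_iff hc).2 hx⟩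
  obtain ⟨hm, hmc⟩ := (h.mem_lowMaximals_iff hc).1 (Finset.min'_mem _ hne)
  refine ⟨_, hm, hmc, ?_⟩
  rw [removeStep, dif_pos hne, if_neg]
  rintro ⟨hcard, hlt⟩
  rw [h.minMaxLevel_eq hc] at hcard hlt
  rw [hcan.topLevel_eq] at hlt
  obtain ⟨y, hy, hyc⟩ := (h.exists_eq_iff _).2 (hc.exists_diag _ _ hlt.le)
  have hmem : ∀ z ∈ P.carrier, (f z).1 = (c (Fin.last n)).1 → z ∈ P.atLevel _ := fun z hz hzc =>
    Finset.mem_filter.2 ⟨hz, (hcan.level_eq hz).trans hzc⟩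
  have hmy := Finset.card_le_one.1 hcard.le _ (hmem _ hm (by rw [hmc])) y (hmem y hy (by rw [hyc]))
  rw [← hmy, hmc] at hyc
  exact hlt.ne' (congrArg Prod.snd hyc)

theorem removeStep (h : P.IsRepresentedBy f c) (hc : IsLaminarCode c) :
    P.removeStep.IsRepresentedBy f (Fin.init c) := by
  obtain ⟨m, hm, hmc, heq⟩ := h.exists_removeStep_eq_erase hc
  rw [heq]
  constructor
  · intro x hx y hy
    simp only [erase, Finset.mem_erase, Finset.mem_filter] at hx hy ⊢
    rw [h.rel_iff x hx.2 y hy.2]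
    simp [hx.1, hy.1]
  · have hmap := h.map_eq
    rw [← Finset.insert_erase hm, Finset.insert_val_of_notMem (Finset.notMem_erase m _),
      Fin.univ_castSuccEmb, Finset.cons_val, Multiset.map_cons, Multiset.map_cons, hmc,
      Multiset.cons_inj_right] at hmap
    simpa [erase, Fin.init_def, Function.comp_def] using hmap

end LaminarCode

variable [LinearOrder ι]

theorem removalLevels_eq {c : Fin n → ℕ × ℕ} (h : P.IsRepresentedBy f c) (hc : IsLaminarCode c) :
    P.removalLevels n = List.ofFn fun k => (c k).1 := by
  induction n generalizing P with
  | zero => simp [removalLevels]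
  | succ n ih =>
    rw [removalLevels, ih (h.removeStep hc) hc.init, h.minMaxLevel_eq hc,
      ofFn_eq_ofFn_init_append]
    rfl

theorem toAscentSeq_eq {c : Fin n → ℕ × ℕ} (h : P.IsRepresentedBy f c) (hc : IsLaminarCode c) :
    P.toAscentSeq = List.ofFn fun k => (c k).1 := by
  have hcard : P.carrier.card = n := by simpa using congrArg Multiset.card h.map_eq
  rw [toAscentSeq, hcard, h.removalLevels_eq hc]

end IsRepresentedBy

end FinPoset

theorem exists_equiv_strictMono_comp {α κ : Type*} [Fintype α] [LinearOrder κ] {key : α → κ}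
    (hkey : Function.Injective key) {m : ℕ} (hm : Fintype.card α = m) :
    ∃ e : Fin m ≃ α, StrictMono (key ∘ e) := by
  let _ : LinearOrder α := LinearOrder.lift' key hkey
  exact ⟨(monoEquivOfFin α hm).toEquiv, fun _ _ h => (monoEquivOfFin α hm).strictMono h⟩

theorem equiv_eq_of_strictMono_comp {α κ : Type*} [LinearOrder κ] {key : α → κ}
    (hkey : Function.Injective key) {m : ℕ} {e e' : Fin m ≃ α} (he : StrictMono (key ∘ e))
    (he' : StrictMono (key ∘ e')) : e = e' := by
  have hcomp : key ∘ e = key ∘ e' := (he.range_inj he').1 (by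
    rw [e.surjective.range_comp, e'.surjective.range_comp])
  exact Equiv.ext fun x => hkey (congrFun hcomp x)

namespace ArcMatching

variable {n : ℕ} {c : Fin n → ℕ × ℕ}

/-- The matching of `2 n` points that are labelled, via `e`, as the opener (`false`) and the closer
(`true`) of the arc number `k`, for `k : Fin n`. -/
def ofEquiv (e : Fin (2 * n) ≃ Fin n × Bool) : ArcMatching n where
  partner x := e.symm ((e x).1, !(e x).2)
  partner_partner x := by simp
  partner_ne x h := by simpa using congrArg (fun y => (e y).2) h

/-- The sorting key for the left end (`false`) and the right end (`true`) of the `k`-th interval: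
ends are sorted by their value, left ends preceding right ends, and ends of the same kind and value
by the opposite ends of their intervals. -/
def endpointKey (c : Fin n → ℕ × ℕ) : Fin n × Bool → ℕ ×ₗ Bool ×ₗ ℕ ×ₗ Fin n
  | (k, false) => toLex ((c k).1, toLex (false, toLex ((c k).2, k)))
  | (k, true) => toLex ((c k).2, toLex (true, toLex ((c k).1, k)))

theorem endpointKey_injective (c : Fin n → ℕ × ℕ) : Function.Injective (endpointKey c) := by
  rintro ⟨j, _ | _⟩ ⟨k, _ | _⟩ h <;>
    simp_all [endpointKey]

theorem exists_strictMono_endpointKey_comp (c : Fin n → ℕ × ℕ) :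
    ∃ e : Fin (2 * n) ≃ Fin n × Bool, StrictMono (endpointKey c ∘ e) :=
  exists_equiv_strictMono_comp (endpointKey_injective c) (by simp [mul_comm])

/-- The ends of the intervals of `c`, listed in increasing order of `endpointKey c`. -/
noncomputable def endpointEquiv (c : Fin n → ℕ × ℕ) : Fin (2 * n) ≃ Fin n × Bool :=
  (exists_strictMono_endpointKey_comp c).choose

/-- The matching with an arc for each interval of `c`, connecting the positions of its ends in
increasing order of `endpointKey c`. -/
noncomputable def ofCode (c : Fin n → ℕ × ℕ) : ArcMatching n :=
  ofEquiv (endpointEquiv c)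

/-- The position of the left end of the `k`-th interval of `c`. -/
noncomputable def leftPos (c : Fin n → ℕ × ℕ) (k : Fin n) : Fin (2 * n) :=
  (endpointEquiv c).symm (k, false)

/-- The position of the right end of the `k`-th interval of `c`. -/
noncomputable def rightPos (c : Fin n → ℕ × ℕ) (k : Fin n) : Fin (2 * n) :=
  (endpointEquiv c).symm (k, true)

theorem strictMono_endpointKey_comp (c : Fin n → ℕ × ℕ) :
    StrictMono (endpointKey c ∘ endpointEquiv c) :=
  (exists_strictMono_endpointKey_comp c).choose_spec

theorem ofEquiv_eq_ofCode {e : Fin (2 * n) ≃ Fin n × Bool} (he : StrictMono (endpointKey c ∘ e)) :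
    ofEquiv e = ofCode c :=
  congrArg ofEquiv <| equiv_eq_of_strictMono_comp (endpointKey_injective c) he
    (strictMono_endpointKey_comp c)

theorem endpointEquiv_symm_lt_iff {x y : Fin n × Bool} :
    (endpointEquiv c).symm x < (endpointEquiv c).symm y ↔ endpointKey c x < endpointKey c y := by
  simp [← (strictMono_endpointKey_comp c).lt_iff_lt]

theorem leftPos_lt_leftPos_iff {j k : Fin n} : leftPos c j < leftPos c k ↔
    (c j).1 < (c k).1 ∨ (c j).1 = (c k).1 ∧
      ((c j).2 < (c k).2 ∨ (c j).2 = (c k).2 ∧ j < k) := by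
  simp [leftPos, endpointEquiv_symm_lt_iff, endpointKey, Prod.Lex.toLex_lt_toLex]

theorem rightPos_lt_rightPos_iff {j k : Fin n} : rightPos c j < rightPos c k ↔
    (c j).2 < (c k).2 ∨ (c j).2 = (c k).2 ∧
      ((c j).1 < (c k).1 ∨ (c j).1 = (c k).1 ∧ j < k) := by
  simp [rightPos, endpointEquiv_symm_lt_iff, endpointKey, Prod.Lex.toLex_lt_toLex]

theorem leftPos_lt_rightPos_iff {j k : Fin n} :
    leftPos c j < rightPos c k ↔ (c j).1 ≤ (c k).2 := by
  simp [leftPos, rightPos, endpointEquiv_symm_lt_iff, endpointKey, Prod.Lex.toLex_lt_toLex,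
    le_iff_lt_or_eq]

theorem rightPos_lt_leftPos_iff {j k : Fin n} :
    rightPos c j < leftPos c k ↔ (c j).2 < (c k).1 := by
  simp [leftPos, rightPos, endpointEquiv_symm_lt_iff, endpointKey, Prod.Lex.toLex_lt_toLex]

theorem exists_eq_leftPos_or_rightPos (c : Fin n → ℕ × ℕ) (x : Fin (2 * n)) :
    ∃ k, x = leftPos c k ∨ x = rightPos c k := by
  refine ⟨(endpointEquiv c x).1, ?_⟩
  simp only [leftPos, rightPos, Equiv.eq_symm_apply]
  rcases endpointEquiv c x with ⟨k, _ | _⟩ <;> simp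

theorem partner_leftPos (c : Fin n → ℕ × ℕ) (k : Fin n) :
    (ofCode c).partner (leftPos c k) = rightPos c k := by
  simp [ofCode, ofEquiv, leftPos, rightPos]

theorem partner_rightPos (c : Fin n → ℕ × ℕ) (k : Fin n) :
    (ofCode c).partner (rightPos c k) = leftPos c k := by
  simp [ofCode, ofEquiv, leftPos, rightPos]

theorem lt_partner_ofCode_iff (hc : ∀ k, (c k).1 ≤ (c k).2) {x : Fin (2 * n)} :
    x < (ofCode c).partner x ↔ ∃ k, leftPos c k = x := by
  constructor
  · intro hx
    obtain ⟨k, rfl | rfl⟩ := exists_eq_leftPos_or_rightPos c x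
    · exact ⟨k, rfl⟩
    · rw [partner_rightPos, rightPos_lt_leftPos_iff] at hx
      exact absurd hx (hc k).not_gt
  · rintro ⟨k, rfl⟩
    rw [partner_leftPos, leftPos_lt_rightPos_iff]
    exact hc k

theorem exists_of_isArc_ofCode (hc : ∀ k, (c k).1 ≤ (c k).2) {a b : Fin (2 * n)}
    (hab : (ofCode c).IsArc a b) : ∃ k, leftPos c k = a ∧ rightPos c k = b := by
  obtain ⟨hlt, rfl⟩ := hab
  obtain ⟨k, rfl⟩ := (lt_partner_ofCode_iff hc).1 hlt
  exact ⟨k, rfl, (partner_leftPos c k).symm⟩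

theorem isStoimenow_ofCode (hc : IsLaminarCode c) : (ofCode c).IsStoimenow := by
  refine ⟨fun a b a' b' hab hab' ⟨hadj, hlt⟩ => ?_, fun a b a' b' hab hab' ⟨hlt, hadj⟩ => ?_⟩ <;>
    obtain ⟨j, rfl, rfl⟩ := exists_of_isArc_ofCode hc.fst_le_snd hab <;>
    obtain ⟨k, rfl, rfl⟩ := exists_of_isArc_ofCode hc.fst_le_snd hab'
  · have hopen := Fin.lt_def.2 (Nat.lt_of_succ_le hadj.ge)
    rw [leftPos_lt_leftPos_iff] at hopen
    rw [rightPos_lt_rightPos_iff] at hlt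
    obtain ⟨i, hi⟩ := hc.exists_diag j _ (hc.fst_le_snd j)
    have hji : leftPos c j < rightPos c i := leftPos_lt_rightPos_iff.2 (by rw [hi])
    have hik : rightPos c i < leftPos c k := rightPos_lt_leftPos_iff.2 (by rw [hi]; omega)
    omega
  · have hclose := Fin.lt_def.2 (Nat.lt_of_succ_le hadj.ge)
    rw [rightPos_lt_rightPos_iff] at hclose
    rw [leftPos_lt_leftPos_iff] at hlt
    obtain ⟨i, hi⟩ := hc.exists_diag j _ le_rfl
    have hij : leftPos c i < rightPos c j := leftPos_lt_rightPos_iff.2 (by rw [hi])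
    have hki : rightPos c k < leftPos c i := rightPos_lt_leftPos_iff.2 (by rw [hi]; omega)
    omega

theorem not_containsP2_ofCode (hc : IsLaminarCode c) : ¬ (ofCode c).ContainsP2 := by
  rintro ⟨a₁, b₁, a₂, b₂, a₃, b₃, a₄, b₄, h₁, h₂, h₃, h₄, -, h21, h13, h32, h24, h43, -⟩
  obtain ⟨k₁, -, rfl⟩ := exists_of_isArc_ofCode hc.fst_le_snd h₁
  obtain ⟨k₂, rfl, rfl⟩ := exists_of_isArc_ofCode hc.fst_le_snd h₂
  obtain ⟨k₃, rfl, rfl⟩ := exists_of_isArc_ofCode hc.fst_le_snd h₃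
  obtain ⟨k₄, rfl, -⟩ := exists_of_isArc_ofCode hc.fst_le_snd h₄
  simp only [leftPos_lt_rightPos_iff, rightPos_lt_leftPos_iff] at h21 h13 h32 h24 h43
  exact (h24.trans_le h43).not_ge (hc.laminar k₂ k₃ (h21.trans_lt h13) h32)

theorem isRepresentedBy_toPoset_ofCode (hc : ∀ k, (c k).1 ≤ (c k).2) :
    (ofCode c).toPoset.IsRepresentedBy (fun x => c (endpointEquiv c x).1) c := by
  have hcarrier : (ofCode c).toPoset.carrier = Finset.univ.image (leftPos c) := by
    ext x
    simp [toPoset, lt_partner_ofCode_iff hc]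
  have hinj : Function.Injective (leftPos c) := fun j k hjk => by simpa [leftPos] using hjk
  constructor
  · simp only [hcarrier, Finset.forall_mem_image]
    intro j _ k _
    have harc : ∀ i, leftPos c i < rightPos c i := fun i => leftPos_lt_rightPos_iff.2 (hc i)
    simp only [toPoset, Finset.mem_filter, Finset.mem_univ, true_and, partner_leftPos, harc,
      rightPos_lt_leftPos_iff]
    simp [leftPos]
  · rw [hcarrier, Finset.image_val_of_injOn hinj.injOn, Multiset.map_map]
    simp [leftPos]

theorem toAscentSeq_ofCode (hc : IsLaminarCode c) :
    (ofCode c).toAscentSeq = List.ofFn fun k => (c k).1 :=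
  (isRepresentedBy_toPoset_ofCode hc.fst_le_snd).toAscentSeq_eq hc

end ArcMatching

namespace ArcMatching

variable {n : ℕ} {M : ArcMatching n}

theorem partner_injective (M : ArcMatching n) : Function.Injective M.partner :=
  Function.LeftInverse.injective M.partner_partner

/-- The point `x` is the opener of an arc of `M`; otherwise it is a closer. -/
def IsOpener (M : ArcMatching n) (x : Fin (2 * n)) : Prop :=
  x < M.partner x

theorem not_isOpener_iff {x : Fin (2 * n)} : ¬ M.IsOpener x ↔ M.partner x < x := by
  rw [IsOpener, not_lt, (M.partner_ne x).le_iff_lt]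

theorem isOpener_partner_iff {x : Fin (2 * n)} : M.IsOpener (M.partner x) ↔ ¬ M.IsOpener x := by
  rw [not_isOpener_iff, IsOpener, M.partner_partner]

theorem IsOpener.isArc {x : Fin (2 * n)} (hx : M.IsOpener x) : M.IsArc x (M.partner x) :=
  ⟨hx, rfl⟩

theorem isArc_partner_of_not_isOpener {x : Fin (2 * n)} (hx : ¬ M.IsOpener x) :
    M.IsArc (M.partner x) x :=
  ⟨not_isOpener_iff.1 hx, M.partner_partner x⟩

section Runs

/-- An opener that immediately follows a closer. -/
def IsRunStart (M : ArcMatching n) (z : Fin (2 * n)) : Prop :=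
  M.IsOpener z ∧ ∃ w, w ⋖ z ∧ ¬ M.IsOpener w

/-- A matching, read from left to right, alternates between maximal runs of openers and maximal runs
of closers. Both the `v`-th run of openers and the run of closers that follows it get the number
`v`, starting from `0`; this is the number of the run that contains `x`. -/
noncomputable def run (M : ArcMatching n) (x : Fin (2 * n)) : ℕ :=
  {z | z ≤ x ∧ M.IsRunStart z}.ncard

theorem run_mono (M : ArcMatching n) : Monotone M.run := fun _ _ hxy =>
  Set.ncard_le_ncard fun _ hz => ⟨hz.1.trans hxy, hz.2⟩

theorem run_lt_run_iff {x y : Fin (2 * n)} :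
    M.run x < M.run y ↔ ∃ z, x < z ∧ z ≤ y ∧ M.IsRunStart z := by
  constructor
  · contrapose!
    exact fun h => Set.ncard_le_ncard fun z hz =>
      ⟨not_lt.1 fun hxz => h z hxz hz.1 hz.2, hz.2⟩
  · rintro ⟨z, hxz, hzy, hz⟩
    refine Set.ncard_lt_ncard ⟨fun w hw => ⟨hw.1.trans (hxz.le.trans hzy), hw.2⟩, fun hsub => ?_⟩
    exact hxz.not_ge (hsub ⟨hzy, hz⟩).1

theorem run_le_run_add_one_of_covBy {x y : Fin (2 * n)} (hxy : x ⋖ y) :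
    M.run y ≤ M.run x + 1 := by
  refine (Set.ncard_le_ncard fun z hz => ?_).trans (Set.ncard_insert_le y _)
  exact hz.1.eq_or_lt.imp_right fun hzy => ⟨hxy.le_of_lt hzy, hz.2⟩

theorem run_lt_run_of_isOpener {x y : Fin (2 * n)} (hxy : x < y) (hx : ¬ M.IsOpener x)
    (hy : M.IsOpener y) : M.run x < M.run y := by
  obtain ⟨z, hzy, hz⟩ :=
    exists_minimal_le_of_wellFoundedLT (fun z => x < z ∧ M.IsOpener z) y ⟨hxy, hy⟩
  obtain ⟨w, hxw, hwz⟩ := exists_le_covBy_of_lt hz.prop.1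
  refine run_lt_run_iff.2 ⟨z, hz.prop.1, hzy, hz.prop.2, w, hwz, fun hw => ?_⟩
  have hne : x ≠ w := by
    rintro rfl
    exact hx hw
  exact hz.not_prop_of_lt hwz.lt ⟨hxw.lt_of_ne hne, hw⟩

theorem isOpener_iff_of_run_eq {x y w : Fin (2 * n)} (hxw : x ≤ w) (hwy : w ≤ y)
    (hrun : M.run x = M.run y) (hkind : M.IsOpener x ↔ M.IsOpener y) :
    M.IsOpener w ↔ M.IsOpener x := by
  have hxw' := M.run_mono hxw
  have hwy' := M.run_mono hwy
  rcases hxw.eq_or_lt with rfl | hxw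
  · rfl
  rcases hwy.eq_or_lt with rfl | hwy
  · exact hkind.symm
  by_contra hne
  by_cases hx : M.IsOpener x
  · have := run_lt_run_of_isOpener hwy (by tauto) (hkind.1 hx)
    omega
  · have := run_lt_run_of_isOpener hxw hx (by tauto)
    omega

theorem exists_closer_run_eq {a : Fin (2 * n)} (ha : M.IsOpener a) :
    ∃ b, ¬ M.IsOpener b ∧ a < b ∧ M.run b = M.run a := by
  obtain ⟨b, hb⟩ := exists_minimal_of_wellFoundedLT (fun b => a < b ∧ ¬ M.IsOpener b)
    ⟨_, ha, isOpener_partner_iff.not_left.2 ha⟩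
  refine ⟨b, hb.prop.2, hb.prop.1, (not_lt.1 fun hlt => ?_).antisymm (M.run_mono hb.prop.1.le)⟩
  obtain ⟨z, haz, hzb, -, w, hwz, hw⟩ := run_lt_run_iff.1 hlt
  have hne : a ≠ w := by
    rintro rfl
    exact hw ha
  exact hb.not_prop_of_lt (hwz.lt.trans_le hzb) ⟨(hwz.le_of_lt haz).lt_of_ne hne, hw⟩

theorem exists_opener_run_eq {b : Fin (2 * n)} (hb : ¬ M.IsOpener b) :
    ∃ a, M.IsOpener a ∧ a < b ∧ M.run a = M.run b := by
  obtain ⟨a, ha⟩ := exists_maximal_of_wellFoundedGT (fun a => a < b ∧ M.IsOpener a)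
    ⟨_, not_isOpener_iff.1 hb, isOpener_partner_iff.2 hb⟩
  refine ⟨a, ha.prop.2, ha.prop.1, (M.run_mono ha.prop.1.le).antisymm (not_lt.1 fun hlt => ?_)⟩
  obtain ⟨z, haz, hzb, hz, -⟩ := run_lt_run_iff.1 hlt
  have hne : z ≠ b := by
    rintro rfl
    exact hb hz
  exact ha.not_prop_of_gt haz ⟨hzb.lt_of_ne hne, hz⟩

theorem exists_run_eq {x : Fin (2 * n)} {v : ℕ} (hv : v ≤ M.run x) : ∃ z, M.run z = v := by
  obtain ⟨z, -, hz⟩ := exists_minimal_le_of_wellFoundedLT (v ≤ M.run ·) x hv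
  refine ⟨z, (not_lt.1 fun hlt => ?_).antisymm hz.prop⟩
  have hne : {w | w ≤ z ∧ M.IsRunStart w}.Nonempty := Set.nonempty_of_ncard_ne_zero hlt.ne_bot
  obtain ⟨u, huz, -, w, hwu, -⟩ := hne
  obtain ⟨y, -, hyz⟩ := exists_le_covBy_of_lt (hwu.lt.trans_le huz)
  have hy := hz.not_prop_of_lt hyz.lt
  have := M.run_le_run_add_one_of_covBy hyz
  omega

theorem exists_isOpener_run_eq {x : Fin (2 * n)} {v : ℕ} (hv : v ≤ M.run x) :
    ∃ a, M.IsOpener a ∧ M.run a = v := by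
  obtain ⟨z, rfl⟩ := exists_run_eq hv
  by_cases hz : M.IsOpener z
  · exact ⟨z, hz, rfl⟩
  · obtain ⟨a, ha, -, hrun⟩ := exists_opener_run_eq hz
    exact ⟨a, ha, hrun⟩

end Runs

section Stoimenow

theorem IsStoimenow.partner_lt_partner_of_covBy (hM : M.IsStoimenow) {x y : Fin (2 * n)}
    (hxy : x ⋖ y) (hkind : M.IsOpener x ↔ M.IsOpener y) : M.partner x < M.partner y := by
  have hval : (x : ℕ) + 1 = y := Nat.covBy_iff_add_one_eq.1 (Fin.covBy_iff.1 hxy)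
  refine (M.partner_injective.ne hxy.lt.ne).lt_of_le (not_lt.1 fun hlt => ?_)
  by_cases hx : M.IsOpener x
  · exact hM.1 _ _ _ _ hx.isArc (hkind.1 hx).isArc ⟨hval.symm, hlt⟩
  · exact hM.2 _ _ _ _ (isArc_partner_of_not_isOpener (hkind.not.1 hx))
      (isArc_partner_of_not_isOpener hx) ⟨hlt, hval.symm⟩

theorem IsStoimenow.partner_lt_partner (hM : M.IsStoimenow) {x y : Fin (2 * n)} (hxy : x < y)
    (hrun : M.run x = M.run y) (hkind : M.IsOpener x ↔ M.IsOpener y) :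
    M.partner x < M.partner y := by
  refine strictMonoOn_of_lt_succ (s := Set.Icc x y) Set.ordConnected_Icc (fun w hw hxw hwy => ?_)
    (Set.left_mem_Icc.2 hxy.le) (Set.right_mem_Icc.2 hxy.le) hxy
  apply hM.partner_lt_partner_of_covBy (Order.covBy_succ_of_not_isMax hw)
  rw [isOpener_iff_of_run_eq hxw.1 hxw.2 hrun hkind, isOpener_iff_of_run_eq hwy.1 hwy.2 hrun hkind]

theorem IsStoimenow.partner_le_partner (hM : M.IsStoimenow) {x y : Fin (2 * n)} (hxy : x ≤ y)
    (hrun : M.run x = M.run y) (hkind : M.IsOpener x ↔ M.IsOpener y) :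
    M.partner x ≤ M.partner y := by
  rcases hxy.eq_or_lt with rfl | hlt
  · rfl
  · exact (hM.partner_lt_partner hlt hrun hkind).le

/-- If the inequality fails, then `[x, M.partner x]` and `[y, M.partner y]` are the two inner arcs
of an occurrence of `P₂`; the outer ones belong to a closer in the run of `x` and an opener in the
run of the partner of `y`. -/
theorem IsStoimenow.run_partner_le_run_partner (hM : M.IsStoimenow) (hP : ¬ M.ContainsP2)
    {x y : Fin (2 * n)} (hx : M.IsOpener x) (hy : M.IsOpener y) (hxy : M.run x < M.run y)
    (hyx : M.run y ≤ M.run (M.partner x)) :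
    M.run (M.partner y) ≤ M.run (M.partner x) := by
  by_contra! hlt
  have hx' : ¬ M.IsOpener (M.partner x) := isOpener_partner_iff.not_left.2 hx
  have hy' : ¬ M.IsOpener (M.partner y) := isOpener_partner_iff.not_left.2 hy
  have hyx' : y < M.partner x := by
    refine lt_of_le_of_ne (not_lt.1 fun h => ?_) fun h => hx' (h ▸ hy)
    exact (run_lt_run_of_isOpener h hx' hy).not_ge hyx
  obtain ⟨b, hb, hxb, hrb⟩ := exists_closer_run_eq hx
  obtain ⟨a, ha, hay, hra⟩ := exists_opener_run_eq hy'
  have hby : b < y := M.run_mono.reflect_lt (hrb.trans_lt hxy)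
  have hxa : M.partner x < a := M.run_mono.reflect_lt (hlt.trans_eq hra.symm)
  have hbx : M.partner b < x := by
    refine not_le.1 fun hle => ?_
    have hrun : M.run x = M.run (M.partner b) :=
      (M.run_mono hle).antisymm (hrb ▸ M.run_mono (not_isOpener_iff.1 hb).le)
    have hnest := hM.partner_le_partner hle hrun (iff_of_true hx (isOpener_partner_iff.2 hb))
    rw [M.partner_partner] at hnest
    exact (hby.trans hyx').not_ge hnest
  have hya : M.partner y < M.partner a := by
    refine not_le.1 fun hle => ?_
    have hrun : M.run (M.partner a) = M.run (M.partner y) :=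
      (M.run_mono hle).antisymm (hra ▸ M.run_mono ha.le)
    have hnest := hM.partner_le_partner hle hrun
      (iff_of_false (isOpener_partner_iff.not_left.2 ha) hy')
    rw [M.partner_partner, M.partner_partner] at hnest
    exact (hyx'.trans hxa).not_ge hnest
  exact hP ⟨_, b, x, _, y, _, a, _, isArc_partner_of_not_isOpener hb, hx.isArc, hy.isArc, ha.isArc,
    hbx, hxb, hby, hyx', hxa, hay, hya⟩

theorem IsStoimenow.exists_isOpener_run_eq_run_partner (hM : M.IsStoimenow) (hP : ¬ M.ContainsP2)
    {x : Fin (2 * n)} {v : ℕ} (hv : v ≤ M.run x) :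
    ∃ a, M.IsOpener a ∧ M.run a = v ∧ M.run (M.partner a) = v := by
  obtain ⟨a, ha, rfl⟩ := exists_isOpener_run_eq hv
  obtain ⟨b, hb, -, hrb⟩ := exists_closer_run_eq ha
  have hb' := isOpener_partner_iff.2 hb
  have hrb' : M.run (M.partner (M.partner b)) = M.run a := by rw [M.partner_partner, hrb]
  rcases (M.run_mono hb'.le).lt_or_eq with hlt | heq
  · have hle := hM.run_partner_le_run_partner hP hb' ha (hlt.trans_eq hrb') hrb'.ge
    exact ⟨a, ha, rfl, (hle.trans_eq hrb').antisymm (M.run_mono ha.le)⟩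
  · exact ⟨M.partner b, hb', heq.trans hrb', hrb'⟩

end Stoimenow

section Code

/-- The points of `M` described by their arcs: the pair `(a, false)` stands for the opener `a` and
`(a, true)` for the closer of its arc. -/
noncomputable def openerProdBoolEquiv (M : ArcMatching n) :
    {x // M.IsOpener x} × Bool ≃ Fin (2 * n) :=
  Equiv.ofBijective (fun p => if p.2 then M.partner p.1 else p.1) <| by
    refine ⟨?_, fun x => ?_⟩
    · rintro ⟨⟨a, ha⟩, _ | _⟩ ⟨⟨b, hb⟩, _ | _⟩ h <;>
        simp only [Bool.false_eq_true, if_true, if_false] at h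
      · simp [h]
      · exact absurd (h ▸ ha) (isOpener_partner_iff.not_left.2 hb)
      · exact absurd (h ▸ hb) (isOpener_partner_iff.not_left.2 ha)
      · simp [M.partner_injective h]
    · by_cases hx : M.IsOpener x
      · exact ⟨(⟨x, hx⟩, false), rfl⟩
      · exact ⟨(⟨M.partner x, isOpener_partner_iff.2 hx⟩, true), M.partner_partner x⟩

theorem openerProdBoolEquiv_false (a : {x // M.IsOpener x}) :
    M.openerProdBoolEquiv (a, false) = a :=
  rfl

theorem openerProdBoolEquiv_true (a : {x // M.IsOpener x}) :
    M.openerProdBoolEquiv (a, true) = M.partner a :=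
  rfl

theorem partner_openerProdBoolEquiv (p : {x // M.IsOpener x} × Bool) :
    M.partner (M.openerProdBoolEquiv p) = M.openerProdBoolEquiv (p.1, !p.2) := by
  rcases p with ⟨a, _ | _⟩
  · rfl
  · exact M.partner_partner a

theorem card_isOpener (M : ArcMatching n) : Nat.card {x // M.IsOpener x} = n := by
  have h := Nat.card_congr M.openerProdBoolEquiv
  simp only [Nat.card_prod, Nat.card_eq_fintype_card, Fintype.card_bool, Fintype.card_fin] at h ⊢
  omega

/-- The key by which the arcs of a matching are sorted in its code: by increasing run of the closer,
then by decreasing run of the opener, then by the opener itself. -/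
noncomputable def arcKey (M : ArcMatching n) (a : {x // M.IsOpener x}) :
    ℕ ×ₗ ℕᵒᵈ ×ₗ {x // M.IsOpener x} :=
  toLex (M.run (M.partner a), toLex (OrderDual.toDual (M.run a), a))

theorem exists_strictMono_arcKey_comp (M : ArcMatching n) :
    ∃ e : Fin n ≃ {x // M.IsOpener x}, StrictMono (M.arcKey ∘ e) := by
  classical
  refine exists_equiv_strictMono_comp (fun a b h => ?_) ?_
  · simp_all [arcKey]
  · rw [← Nat.card_eq_fintype_card, M.card_isOpener]

/-- The arcs of `M`, given by their openers, in increasing order of `M.arcKey`. -/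
noncomputable def arcEquiv (M : ArcMatching n) : Fin n ≃ {x // M.IsOpener x} :=
  M.exists_strictMono_arcKey_comp.choose

/-- The list of the pairs (run of the opener, run of the closer) of the arcs of `M`, in increasing
order of `M.arcKey`. -/
noncomputable def code (M : ArcMatching n) (k : Fin n) : ℕ × ℕ :=
  (M.run (M.arcEquiv k), M.run (M.partner (M.arcEquiv k)))

theorem arcEquiv_symm_lt_arcEquiv_symm_iff {a b : {x // M.IsOpener x}} :
    M.arcEquiv.symm a < M.arcEquiv.symm b ↔ M.arcKey a < M.arcKey b := by
  have h : StrictMono (M.arcKey ∘ M.arcEquiv) := M.exists_strictMono_arcKey_comp.choose_spec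
  simp [← h.lt_iff_lt]

theorem code_arcEquiv_symm (a : {x // M.IsOpener x}) :
    M.code (M.arcEquiv.symm a) = (M.run a, M.run (M.partner a)) := by
  simp [code]

theorem IsStoimenow.isLaminarCode_code (hM : M.IsStoimenow) (hP : ¬ M.ContainsP2) :
    IsLaminarCode M.code where
  fst_le_snd k := M.run_mono (M.arcEquiv k).2.le
  laminar j k := hM.run_partner_le_run_partner hP (M.arcEquiv j).2 (M.arcEquiv k).2
  exists_diag k v hv := by
    obtain ⟨a, ha, hrun, hrun'⟩ := hM.exists_isOpener_run_eq_run_partner hP hv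
    exact ⟨M.arcEquiv.symm ⟨a, ha⟩, by rw [code_arcEquiv_symm, hrun, hrun']⟩
  sorted j k hjk := by
    rw [← M.arcEquiv.symm_apply_apply j, ← M.arcEquiv.symm_apply_apply k,
      arcEquiv_symm_lt_arcEquiv_symm_iff] at hjk
    simp only [arcKey, Prod.Lex.toLex_lt_toLex, OrderDual.toDual_lt_toDual] at hjk
    simp only [code]
    rw [OrderDual.toDual_inj] at hjk
    omega

/-- The points of `M`, labelled by the position of their arc in `M.code` and by their kind. -/
noncomputable def pointEquiv (M : ArcMatching n) : Fin (2 * n) ≃ Fin n × Bool :=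
  M.openerProdBoolEquiv.symm.trans (M.arcEquiv.symm.prodCongr (Equiv.refl Bool))

theorem ofEquiv_pointEquiv (M : ArcMatching n) : ofEquiv M.pointEquiv = M := by
  refine ArcMatching.ext (funext fun x => ?_)
  obtain ⟨p, rfl⟩ := M.openerProdBoolEquiv.surjective x
  simp [ofEquiv, pointEquiv, partner_openerProdBoolEquiv]

theorem IsStoimenow.strictMono_endpointKey_comp_pointEquiv (hM : M.IsStoimenow) :
    StrictMono (endpointKey M.code ∘ M.pointEquiv) := by
  intro x y hxy
  obtain ⟨⟨a, s⟩, rfl⟩ := M.openerProdBoolEquiv.surjective x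
  obtain ⟨⟨b, t⟩, rfl⟩ := M.openerProdBoolEquiv.surjective y
  have hrun := (M.run_mono hxy.le).lt_or_eq
  rcases s with _ | _ <;> rcases t with _ | _ <;>
    simp only [openerProdBoolEquiv_false, openerProdBoolEquiv_true] at hxy hrun <;>
    simp only [Function.comp_apply, pointEquiv, Equiv.trans_apply, Equiv.symm_apply_apply,
      Equiv.prodCongr_apply, Prod.map_apply, Equiv.refl_apply, endpointKey, code_arcEquiv_symm,
      Prod.Lex.toLex_lt_toLex, arcEquiv_symm_lt_arcEquiv_symm_iff, arcKey,
      OrderDual.toDual_lt_toDual, OrderDual.toDual_inj, lt_irrefl, false_or, true_and,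
      Bool.false_lt_true, true_or, and_true]
  · refine hrun.imp_right fun heq => ⟨heq, ?_⟩
    have hpartner := hM.partner_lt_partner hxy heq (iff_of_true a.2 b.2)
    exact (M.run_mono hpartner.le).lt_or_eq.imp_right fun h => ⟨h, .inr ⟨h, .inr ⟨heq, hxy⟩⟩⟩
  · exact hrun
  · exact .inl (run_lt_run_of_isOpener hxy (isOpener_partner_iff.not_left.2 a.2) b.2)
  · refine hrun.imp_right fun heq => ⟨heq, ?_⟩
    have hab := hM.partner_lt_partner hxy heq <|
      iff_of_false (isOpener_partner_iff.not_left.2 a.2) (isOpener_partner_iff.not_left.2 b.2)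
    rw [M.partner_partner, M.partner_partner] at hab
    exact (M.run_mono hab.le).lt_or_eq.imp_right fun h => ⟨h, .inr ⟨heq, .inr ⟨h, hab⟩⟩⟩

theorem IsStoimenow.exists_ofCode_eq (hM : M.IsStoimenow) (hP : ¬ M.ContainsP2) :
    ∃ c, IsLaminarCode c ∧ ofCode c = M :=
  ⟨M.code, hM.isLaminarCode_code hP,
    (ofEquiv_eq_ofCode hM.strictMono_endpointKey_comp_pointEquiv).symm.trans M.ofEquiv_pointEquiv⟩

end Code

end ArcMatching

theorem image_ofCode_isLaminarCode (n : ℕ) :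
    ArcMatching.ofCode '' {c : Fin n → ℕ × ℕ | IsLaminarCode c} = stoimenowAvoidingP2 n := by
  ext M
  constructor
  · rintro ⟨c, hc, rfl⟩
    exact ⟨ArcMatching.isStoimenow_ofCode hc, ArcMatching.not_containsP2_ofCode hc⟩
  · exact fun ⟨hM, hP⟩ => hM.exists_ofCode_eq hP

theorem mainTheorem9 (n : ℕ) :
    Set.BijOn (ArcMatching.toAscentSeq (n := n)) (stoimenowAvoidingP2 n)
      (ascentSeqAvoiding101 n) := by
  have hcomp : Set.BijOn (ArcMatching.toAscentSeq ∘ ArcMatching.ofCode)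
      {c : Fin n → ℕ × ℕ | IsLaminarCode c} (ascentSeqAvoiding101 n) :=
    (bijOn_ofFn_fst n).congr fun _ hc => (ArcMatching.toAscentSeq_ofCode hc).symm
  rw [← image_ofCode_isLaminarCode]
  exact (Set.bijOn_comp_iff (Set.InjOn.of_comp hcomp.injOn)).1 hcomp
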